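/- Let $\mathcal C=\{x\in\mathbb C^3 : f_1(x)=f_2(x)=0\}$, with $f_1,f_2\in\mathbb C[x_1,x_2,x_3]$, be an irreducible algebraic curve. Its degree $\deg(\mathcal C)$ is the maximal number of points in which a plane not containing $\mathcal C$ meets $\mathcal C$. Let $$\varphi_k(t)=m_k+a_{1,k}t^{N_{1,k}/N_k}+a_{2,k}t^{N_{2,k}/N_k}+\cdots\qquad(k=2,3),\qquad 0<N_{1,k}<N_{2,k}<\cdots,$$ be (finite or infinite) complex Puiseux series with nonzero $a_{i,k}$, where $N_k\ge 1$ is the ramification index of $\varphi_k$, i.e. the least common denominator of its exponents. Assume that $f_i(t^{-1},t^{-1}\varphi_2(t),t^{-1}\varphi_3(t))=0$ for $i=1,2$ as formal series, and that for some $M>0$ the series $r_k(z)=z\varphi_k(z^{-1})$ converge for all $z\in\mathbb C$ with $|z|>M$; that is, $B=\{(z,r_2(z),r_3(z)) : |z|>M\}$ defines an infinity branch of $\mathcal C$ at the infinity point $(1:m_2:m_3:0)$. Let $N=\operatorname{lcm}(N_2,N_3)$ be its ramification index and, for $\varepsilon\in\mathbb C$ with $\varepsilon^N=1$, let $$r_k^{\varepsilon}(z)=m_kz+\sum_{i\ge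 1}a_{i,k}\,\varepsilon^{N N_{i,k}/N_k}\,z^{1-N_{i,k}/N_k}$$ be the conjugate series (all powers of $z$ being taken with the principal branch). Then: 1. $\deg(\mathcal C)\ge N$. 2. Every conjugate leaf $\{(z,r_2^{\varepsilon}(z),r_3^{\varepsilon}(z)) : |z|>M\}$, $\varepsilon^N=1$, is contained in $\mathcal C$. 3. There is $M'\ge M$ such that for every $z_0\in\mathbb C$ with $|z_0|>M'$ the points $(z_0,r_2^{\varepsilon}(z_0),r_3^{\varepsilon}(z_0))$, $\varepsilon^N=1$, are $N$ distinct points of the intersection of $\mathcal C$ with the plane $x_1=z_0$. -/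

import Mathlib

/-! Irreducible algebraic curves in affine three-space over the complex numbers, their degree,
and their infinity branches given by convergent Puiseux series.  The coordinates
`x₁, x₂, x₃` are `x 0, x 1, x 2`. -/

namespace SpaceCurve

/-- The locus `C = V(f₁, f₂)` in `ℂ³`. -/
def locus (f₁ f₂ : MvPolynomial (Fin 3) ℂ) : Set (Fin 3 → ℂ) :=
  {x | MvPolynomial.eval x f₁ = 0 ∧ MvPolynomial.eval x f₂ = 0}

/-- `C` is an irreducible curve: its ideal is prime (so `C` is irreducible and nonempty) and its
coordinate ring has Krull dimension one. -/
def IsIrreducibleCurve (C : Set (Fin 3 → ℂ)) : Prop :=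
  (MvPolynomial.vanishingIdeal ℂ C).IsPrime ∧
    ringKrullDim (MvPolynomial (Fin 3) ℂ ⧸ MvPolynomial.vanishingIdeal ℂ C) = 1

/-- `H` is an (affine) plane in `ℂ³`. -/
def IsPlane (H : Set (Fin 3 → ℂ)) : Prop :=
  ∃ (a : Fin 3 → ℂ) (b : ℂ), a ≠ 0 ∧ H = {x | ∑ i, a i * x i = b}

/-- The degree of an irreducible space curve: the maximal number of points in which the curve is
met by a plane that does not contain it.  A general plane attains this maximum, and its
intersection points with the projective closure of the curve are simple and finite, so that
this is the usual degree.  It is a supremum in `ℕ∞`, so no boundedness has to be checked for it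
to have its meaning. -/
noncomputable def degree (C : Set (Fin 3 → ℂ)) : ℕ∞ :=
  ⨆ H ∈ {H : Set (Fin 3 → ℂ) | IsPlane H ∧ ¬ C ⊆ H}, (C ∩ H).encard

/-- All exponents of `φ = ∑ a_q t ^ q` are of the form `i / n` with a natural number `i`. -/
def HasDenominator (φ : HahnSeries ℚ ℂ) (n : ℕ) : Prop :=
  0 < n ∧ ∀ q ∈ φ.support, ∃ i : ℕ, q = (i : ℚ) / (n : ℚ)

/-- Puiseux series `m + a₁ t ^ (N₁ / N) + a₂ t ^ (N₂ / N) + ⋯` with `0 < N₁ < N₂ < ⋯`,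
realized inside the Hahn series with rational exponents. Here `m` is `φ.coeff 0`. -/
def IsPuiseux (φ : HahnSeries ℚ ℂ) : Prop := ∃ n : ℕ, HasDenominator φ n

/-- The ramification index `ν(φ)`: the least common denominator of the exponents of `φ`. -/
noncomputable def ramificationIndex (φ : HahnSeries ℚ ℂ) : ℕ := sInf {n : ℕ | HasDenominator φ n}

/-- The conjugate `∑ a_q ε ^ (q N) t ^ q` of `φ = ∑ a_q t ^ q`, meant for `ε ^ N = 1` and `N` a
common denominator of the exponents, so that `q N` is a natural number whenever `a_q ≠ 0`. -/
noncomputable def conjugate (N : ℕ) (ε : ℂ) (φ : HahnSeries ℚ ℂ) : HahnSeries ℚ ℂ where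
  coeff q := φ.coeff q * ε ^ (q * (N : ℚ)).num
  isPWO_support' := φ.isPWO_support.mono fun q hq => by
    have hq' : φ.coeff q * ε ^ (q * (N : ℚ)).num ≠ 0 := hq
    exact (HahnSeries.mem_support φ q).mpr (left_ne_zero_of_mul hq')

/-- The terms `a_q z ^ (1 - q)` of `r(z) = z φ(1 / z)`, with the principal branch of the power. -/
noncomputable def term (φ : HahnSeries ℚ ℂ) (z : ℂ) (q : ℚ) : ℂ :=
  φ.coeff q * z ^ (((1 - q : ℚ)) : ℂ)

/-- `r(z) = z φ(1 / z) = m z + a₁ z ^ (1 - N₁ / N) + a₂ z ^ (1 - N₂ / N) + ⋯`. -/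
noncomputable def r (φ : HahnSeries ℚ ℂ) (z : ℂ) : ℂ := ∑' q : ℚ, term φ z q

/-- The point `(z, r₂(z), r₃(z))` given by the series `φ₂, φ₃`. -/
noncomputable def branchPoint (φ₂ φ₃ : HahnSeries ℚ ℂ) (z : ℂ) : Fin 3 → ℂ :=
  ![z, r φ₂ z, r φ₃ z]

/-- The leaf `{(z, r₂(z), r₃(z)) : |z| > M}`. -/
def leaf (φ₂ φ₃ : HahnSeries ℚ ℂ) (M : ℝ) : Set (Fin 3 → ℂ) :=
  branchPoint φ₂ φ₃ '' {z : ℂ | M < ‖z‖}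

/-- The formal series `1 / t`. -/
noncomputable def tInv : HahnSeries ℚ ℂ := HahnSeries.single (-1) 1

/-- `f (1/t, φ₂(t)/t, φ₃(t)/t) = 0` as a formal series; after multiplication with the power of `t`
given by the degree of `f` this is `F (1 : φ₂ : φ₃ : t) = 0` for the homogenization `F` of `f`. -/
def IsFormalZero (f : MvPolynomial (Fin 3) ℂ) (φ₂ φ₃ : HahnSeries ℚ ℂ) : Prop :=
  MvPolynomial.aeval ![tInv, tInv * φ₂, tInv * φ₃] f = 0

/-- The pair `(φ₂, φ₃)` of Puiseux series and `M > 0` define an infinity branch of the curve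
`f₁ = f₂ = 0`, associated to the infinity point `(1 : m₂ : m₃ : 0)`: the pair is a formal solution
of the system and both series converge for `|z| > M`.  The leaves of the branch are
`leaf (conjugate N ε φ₂) (conjugate N ε φ₃) M` for `ε ^ N = 1`,
with `N = lcm (ν(φ₂), ν(φ₃))`. -/
structure IsInfinityBranch (f₁ f₂ : MvPolynomial (Fin 3) ℂ) (m₂ m₃ : ℂ)
    (φ₂ φ₃ : HahnSeries ℚ ℂ) (M : ℝ) : Prop where
  puiseux₂ : IsPuiseux φ₂
  puiseux₃ : IsPuiseux φ₃
  coeff_zero₂ : φ₂.coeff 0 = m₂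
  coeff_zero₃ : φ₃.coeff 0 = m₃
  solves₁ : IsFormalZero f₁ φ₂ φ₃
  solves₂ : IsFormalZero f₂ φ₂ φ₃
  pos : 0 < M
  summable₂ : ∀ z : ℂ, M < ‖z‖ → Summable (term φ₂ z)
  summable₃ : ∀ z : ℂ, M < ‖z‖ → Summable (term φ₃ z)

/-- The ramification index `N = lcm (N₂, N₃)` of the branch given by `(φ₂, φ₃)`. -/
noncomputable def branchRamification (φ₂ φ₃ : HahnSeries ℚ ℂ) : ℕ :=
  Nat.lcm (ramificationIndex φ₂) (ramificationIndex φ₃)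

end SpaceCurve

namespace SpaceCurve

open Filter Topology

/-! ### Ramification indices -/

/-! In the variable `s = t ^ (1 / N)` both `φ₂` and `φ₃` are ordinary power series (`rootSeries`),
and conjugation by `ε` is the substitution `s ↦ ε s`. The formal equations are identities of Laurent
series in `s`, so they can be evaluated at every `s ≠ 0` where the series converge absolutely. At `s
= ε z ^ (-1 / N)` one has `s ^ (-N) = z`, and the evaluation says that the conjugate point over `z`
lies on the curve (`eval_eq_zero_of_isFormalZero`).

For `ε ≠ δ`, minimality of `N` gives an exponent `i / N` of `φ₂` or `φ₃` with `ε ^ i ≠ δ ^ i`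
(`exists_coeff_ne_zero_pow_ne`). The two conjugates of that series then differ by `z` times a
nonzero convergent power series in `z ^ (-1 / N)`, whose zeros are isolated. There are finitely many
pairs, so one `M'` separates all `N` points. A plane `x₁ = z` with `|z| > M'` thus meets the curve
in `N` points at least; it does not contain the curve, which has points over other `z`. -/

theorem hasDenominator_iff {φ : HahnSeries ℚ ℂ} {n : ℕ} :
    HasDenominator φ n ↔ 0 < n ∧ ∀ q ∈ φ.support, 0 ≤ q ∧ q.den ∣ n := by
  refine and_congr_right fun hn => forall₂_congr fun q _ => ?_
  have hn' : (n : ℚ) ≠ 0 := by positivity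
  constructor
  · rintro ⟨i, rfl⟩
    refine ⟨by positivity, ?_⟩
    have h := Rat.den_dvd (i : ℤ) (n : ℤ)
    rw [Rat.divInt_eq_div] at h
    exact_mod_cast h
  · rintro ⟨hq, d, rfl⟩
    have hd : (d : ℚ) ≠ 0 := by
      rintro h
      simp [h] at hn'
    refine ⟨q.num.toNat * d, ?_⟩
    have hnum : ((q.num.toNat : ℕ) : ℚ) = (q.num : ℚ) := by
      exact_mod_cast Int.toNat_of_nonneg (Rat.num_nonneg.mpr hq)
    push_cast
    rw [hnum, mul_div_mul_right _ _ hd, Rat.num_div_den]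

theorem hasDenominator_ramificationIndex {φ : HahnSeries ℚ ℂ} (h : IsPuiseux φ) :
    HasDenominator φ (ramificationIndex φ) :=
  Nat.sInf_mem (s := {n : ℕ | HasDenominator φ n}) h

theorem HasDenominator.of_dvd {φ : HahnSeries ℚ ℂ} {m n : ℕ} (h : HasDenominator φ m)
    (hn : 0 < n) (hmn : m ∣ n) : HasDenominator φ n :=
  hasDenominator_iff.mpr ⟨hn, fun q hq =>
    ⟨((hasDenominator_iff.mp h).2 q hq).1, ((hasDenominator_iff.mp h).2 q hq).2.trans hmn⟩⟩

/-- Common denominators are closed under gcd, so the least one divides all others. -/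
theorem HasDenominator.ramificationIndex_dvd {φ : HahnSeries ℚ ℂ} {n : ℕ}
    (h : HasDenominator φ n) : ramificationIndex φ ∣ n := by
  have h₁ := hasDenominator_iff.mp (hasDenominator_ramificationIndex ⟨n, h⟩)
  have h₂ := hasDenominator_iff.mp h
  have hg : HasDenominator φ (Nat.gcd (ramificationIndex φ) n) :=
    hasDenominator_iff.mpr ⟨Nat.gcd_pos_of_pos_left _ h₁.1, fun q hq =>
      ⟨(h₁.2 q hq).1, Nat.dvd_gcd (h₁.2 q hq).2 (h₂.2 q hq).2⟩⟩
  have hle : ramificationIndex φ ≤ Nat.gcd (ramificationIndex φ) n := Nat.sInf_le hg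
  exact (Nat.gcd_eq_left_iff_dvd).mp
    (le_antisymm (Nat.le_of_dvd h₁.1 (Nat.gcd_dvd_left _ _)) hle)

/-- If `η` fixes every exponent of `φ` with common denominator `N`, then `N` may be divided by
the order of `η`. -/
theorem HasDenominator.div_orderOf {φ : HahnSeries ℚ ℂ} {N : ℕ} (h : HasDenominator φ N) {η : ℂ}
    (hη : η ^ N = 1) (hφ : ∀ i : ℕ, φ.coeff ((i : ℚ) / N) ≠ 0 → η ^ i = 1) :
    HasDenominator φ (N / orderOf η) := by
  obtain ⟨d, hd⟩ := orderOf_dvd_of_pow_eq_one hη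
  have hN := h.1
  have ho : 0 < orderOf η := Nat.pos_of_ne_zero fun h0 => by simp [h0] at hd; omega
  have hd0 : 0 < d := Nat.pos_of_ne_zero fun h0 => by simp [h0] at hd; omega
  have hdiv : N / orderOf η = d := by rw [hd]; exact Nat.mul_div_cancel_left d ho
  rw [hdiv]
  refine ⟨hd0, fun q hq => ?_⟩
  obtain ⟨i, rfl⟩ := h.2 q hq
  obtain ⟨j, rfl⟩ := orderOf_dvd_of_pow_eq_one (hφ i hq)
  refine ⟨j, ?_⟩
  have ho' : ((orderOf η : ℕ) : ℚ) ≠ 0 := by positivity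
  generalize orderOf η = o at *
  subst hd
  push_cast
  rw [mul_div_mul_left _ _ ho']

/-- Otherwise `η = ε / δ` satisfies `η ^ i = 1` for all exponents `i / N` of both series. Then `N /
orderOf η` is a common denominator of each, hence a multiple of the lcm `N`, which forces `orderOf η
= 1`. -/
theorem exists_coeff_ne_zero_pow_ne {φ₂ φ₃ : HahnSeries ℚ ℂ} (h₂ : IsPuiseux φ₂)
    (h₃ : IsPuiseux φ₃) {ε δ : ℂ} (hε : ε ^ branchRamification φ₂ φ₃ = 1)
    (hδ : δ ^ branchRamification φ₂ φ₃ = 1) (hne : ε ≠ δ) :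
    (∃ i : ℕ, φ₂.coeff ((i : ℚ) / branchRamification φ₂ φ₃) * (ε ^ i - δ ^ i) ≠ 0) ∨
      ∃ i : ℕ, φ₃.coeff ((i : ℚ) / branchRamification φ₂ φ₃) * (ε ^ i - δ ^ i) ≠ 0 := by
  by_contra! hcon
  obtain ⟨hc₂, hc₃⟩ := hcon
  have hp₂ := hasDenominator_ramificationIndex h₂
  have hp₃ := hasDenominator_ramificationIndex h₃
  have hN : 0 < branchRamification φ₂ φ₃ := Nat.lcm_pos hp₂.1 hp₃.1
  have hd₂ := hp₂.of_dvd hN (Nat.dvd_lcm_left _ _)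
  have hd₃ := hp₃.of_dvd hN (Nat.dvd_lcm_right _ _)
  have hδ0 : δ ≠ 0 := by
    rintro rfl
    rw [zero_pow hN.ne'] at hδ
    exact zero_ne_one hδ
  have key : ∀ (a : ℂ) (i : ℕ), a * (ε ^ i - δ ^ i) = 0 → a ≠ 0 → (ε / δ) ^ i = 1 := by
    intro a i h ha
    rw [div_pow, div_eq_one_iff_eq (pow_ne_zero _ hδ0)]
    exact sub_eq_zero.mp ((mul_eq_zero.mp h).resolve_left ha)
  have hη : (ε / δ) ^ branchRamification φ₂ φ₃ = 1 := by rw [div_pow, hε, hδ, div_one]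
  have e₂ := (hd₂.div_orderOf hη fun i hi => key _ i (hc₂ i) hi).ramificationIndex_dvd
  have e₃ := (hd₃.div_orderOf hη fun i hi => key _ i (hc₃ i) hi).ramificationIndex_dvd
  have e := Nat.lcm_dvd e₂ e₃
  change branchRamification φ₂ φ₃ ∣ _ at e
  have ho : orderOf (ε / δ) = 1 := by
    have ho' := orderOf_dvd_of_pow_eq_one hη
    obtain ⟨d, hd⟩ := ho'
    have hopos : 0 < orderOf (ε / δ) := Nat.pos_of_ne_zero fun h0 => by simp [h0] at hd; omega
    have hd0 : 0 < d := Nat.pos_of_ne_zero fun h0 => by simp [h0] at hd; omega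
    have hdiv : branchRamification φ₂ φ₃ / orderOf (ε / δ) = d := by
      rw [hd]; exact Nat.mul_div_cancel_left d hopos
    rw [hdiv] at e
    have hle := Nat.le_of_dvd hd0 e
    rw [hd] at hle
    have : orderOf (ε / δ) ≤ 1 := by
      by_contra! hlt
      nlinarith
    omega
  rw [orderOf_eq_one_iff, div_eq_one_iff_eq hδ0] at ho
  exact hne ho

/-! ### Power series in a root of the variable, and their values -/

/-- The map `i ↦ i / N` on exponents. -/
noncomputable def divExponent (N : ℕ) : ℕ →+ ℚ :=
  (AddMonoidHom.mulRight (N : ℚ)⁻¹).comp (Nat.castAddMonoidHom ℚ)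

theorem divExponent_apply (N i : ℕ) : divExponent N i = (i : ℚ) / N := by
  simp [divExponent, div_eq_mul_inv]

theorem divExponent_le_iff {N : ℕ} (hN : 0 < N) (i j : ℕ) :
    divExponent N i ≤ divExponent N j ↔ i ≤ j := by
  have : (0 : ℚ) < N := by exact_mod_cast hN
  rw [divExponent_apply, divExponent_apply, div_le_div_iff_of_pos_right this, Nat.cast_le]

theorem divExponent_injective {N : ℕ} (hN : 0 < N) : Function.Injective (divExponent N) :=
  fun i j h => le_antisymm ((divExponent_le_iff hN i j).mp h.le)
    ((divExponent_le_iff hN j i).mp h.ge)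

/-- The substitution `X ↦ t ^ (1 / N)`. -/
noncomputable def puiseuxHom {N : ℕ} (hN : 0 < N) : PowerSeries ℂ →+* HahnSeries ℚ ℂ :=
  (HahnSeries.embDomainRingHom (divExponent N) (divExponent_injective hN)
    (divExponent_le_iff hN)).comp HahnSeries.toPowerSeries.symm.toRingHom

theorem puiseuxHom_injective {N : ℕ} (hN : 0 < N) : Function.Injective (puiseuxHom hN) :=
  HahnSeries.embDomain_injective.comp HahnSeries.toPowerSeries.symm.injective

theorem puiseuxHom_coeff {N : ℕ} (hN : 0 < N) (P : PowerSeries ℂ) (i : ℕ) :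
    (puiseuxHom hN P).coeff ((i : ℚ) / N) = PowerSeries.coeff i P := by
  rw [← divExponent_apply]
  exact HahnSeries.embDomain_coeff

theorem puiseuxHom_coeff_of_notMem {N : ℕ} (hN : 0 < N) (P : PowerSeries ℂ) {q : ℚ}
    (hq : ∀ i : ℕ, q ≠ (i : ℚ) / N) : (puiseuxHom hN P).coeff q = 0 := by
  refine HahnSeries.embDomain_of_notMem_range ?_
  rintro ⟨i, hi⟩
  exact hq i (by rw [← divExponent_apply]; exact hi.symm)

theorem puiseuxHom_C {N : ℕ} (hN : 0 < N) (a : ℂ) :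
    puiseuxHom hN (PowerSeries.C a) = HahnSeries.C a := by
  have h : HahnSeries.toPowerSeries.symm (PowerSeries.C a) = (HahnSeries.C a : HahnSeries ℕ ℂ) := by
    rw [RingEquiv.symm_apply_eq]
    ext n
    rw [HahnSeries.coeff_toPowerSeries, PowerSeries.coeff_C, HahnSeries.C_apply,
      HahnSeries.coeff_single]
    congr
  change HahnSeries.embDomainRingHom _ _ _ (HahnSeries.toPowerSeries.symm (PowerSeries.C a)) = _
  rw [h, HahnSeries.embDomainRingHom_C]

theorem tInv_mul_puiseuxHom {N : ℕ} (hN : 0 < N) :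
    tInv * puiseuxHom hN (PowerSeries.X ^ N) = 1 := by
  have hN' : (N : ℚ) ≠ 0 := by positivity
  have h : puiseuxHom hN (PowerSeries.X ^ N) = HahnSeries.single (1 : ℚ) (1 : ℂ) := by
    ext q
    by_cases hq : ∃ i : ℕ, q = (i : ℚ) / N
    · obtain ⟨i, rfl⟩ := hq
      rw [puiseuxHom_coeff, PowerSeries.coeff_X_pow, HahnSeries.coeff_single]
      have : (i : ℚ) / N = 1 ↔ i = N := by rw [div_eq_one_iff_eq hN', Nat.cast_inj]
      simp only [this]
    · push Not at hq
      rw [puiseuxHom_coeff_of_notMem hN _ hq, HahnSeries.coeff_single_of_ne]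
      rintro rfl
      exact hq N (div_self hN').symm
  rw [h, tInv, HahnSeries.single_mul_single]
  simp

/-- `φ` as a power series in `t ^ (1 / N)`. -/
noncomputable def rootSeries (N : ℕ) (φ : HahnSeries ℚ ℂ) : PowerSeries ℂ :=
  PowerSeries.mk fun i => φ.coeff ((i : ℚ) / N)

theorem HasDenominator.puiseuxHom_rootSeries {N : ℕ} {φ : HahnSeries ℚ ℂ}
    (h : HasDenominator φ N) : puiseuxHom h.1 (rootSeries N φ) = φ := by
  ext q
  by_cases hq : ∃ i : ℕ, q = (i : ℚ) / N
  · obtain ⟨i, rfl⟩ := hq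
    rw [puiseuxHom_coeff, rootSeries, PowerSeries.coeff_mk]
  · rw [puiseuxHom_coeff_of_notMem h.1 _ (by simpa using hq)]
    by_contra hne
    exact hq (h.2 q (Ne.symm hne))

/-- `P` converges absolutely at `s`, with value `v`. -/
def ConvergesTo (P : PowerSeries ℂ) (s v : ℂ) : Prop :=
  (Summable fun n => ‖PowerSeries.coeff n P * s ^ n‖) ∧ v = ∑' n, PowerSeries.coeff n P * s ^ n

theorem ConvergesTo.add {P Q : PowerSeries ℂ} {s v w : ℂ} (hP : ConvergesTo P s v)
    (hQ : ConvergesTo Q s w) : ConvergesTo (P + Q) s (v + w) := by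
  have h : ∀ n, PowerSeries.coeff n (P + Q) * s ^ n =
      PowerSeries.coeff n P * s ^ n + PowerSeries.coeff n Q * s ^ n := fun n => by
    rw [map_add, add_mul]
  refine ⟨?_, ?_⟩
  · simp only [h]
    exact (hP.1.add hQ.1).of_nonneg_of_le (fun _ => norm_nonneg _) fun n => norm_add_le _ _
  · simp only [h]
    rw [hP.1.of_norm.tsum_add hQ.1.of_norm, hP.2, hQ.2]

theorem ConvergesTo.mul {P Q : PowerSeries ℂ} {s v w : ℂ} (hP : ConvergesTo P s v)
    (hQ : ConvergesTo Q s w) : ConvergesTo (P * Q) s (v * w) := by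
  have h : ∀ n, PowerSeries.coeff n (P * Q) * s ^ n =
      ∑ kl ∈ Finset.HasAntidiagonal.antidiagonal n,
        (PowerSeries.coeff kl.1 P * s ^ kl.1) * (PowerSeries.coeff kl.2 Q * s ^ kl.2) := by
    intro n
    rw [PowerSeries.coeff_mul, Finset.sum_mul]
    refine Finset.sum_congr rfl fun kl hkl => ?_
    rw [← Finset.HasAntidiagonal.mem_antidiagonal.mp hkl, pow_add]
    ring
  refine ⟨?_, ?_⟩
  · simp only [h]
    exact summable_norm_sum_mul_antidiagonal_of_summable_norm
      (f := fun n => PowerSeries.coeff n P * s ^ n) (g := fun n => PowerSeries.coeff n Q * s ^ n)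
      hP.1 hQ.1
  · simp only [h]
    rw [hP.2, hQ.2]
    exact tsum_mul_tsum_eq_tsum_sum_antidiagonal_of_summable_norm
      (f := fun n => PowerSeries.coeff n P * s ^ n) (g := fun n => PowerSeries.coeff n Q * s ^ n)
      hP.1 hQ.1

theorem convergesTo_C (a s : ℂ) : ConvergesTo (PowerSeries.C a) s a := by
  have h : ∀ n, n ≠ 0 → PowerSeries.coeff n (PowerSeries.C a) * s ^ n = 0 := fun n hn => by
    rw [PowerSeries.coeff_C, if_neg hn, zero_mul]
  refine ⟨summable_of_ne_finset_zero (s := {0}) fun n hn => ?_, ?_⟩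
  · rw [h n (by simpa using hn), norm_zero]
  · rw [tsum_eq_single 0 h]
    simp

theorem convergesTo_X (s : ℂ) : ConvergesTo PowerSeries.X s s := by
  have h : ∀ n, n ≠ 1 → PowerSeries.coeff n (PowerSeries.X : PowerSeries ℂ) * s ^ n = 0 :=
    fun n hn => by rw [PowerSeries.coeff_X, if_neg hn, zero_mul]
  refine ⟨summable_of_ne_finset_zero (s := {1}) fun n hn => ?_, ?_⟩
  · rw [h n (by simpa using hn), norm_zero]
  · rw [tsum_eq_single 1 h]
    simp

theorem convergesTo_X_pow (s : ℂ) (k : ℕ) : ConvergesTo (PowerSeries.X ^ k) s (s ^ k) := by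
  induction k with
  | zero => simpa using convergesTo_C 1 s
  | succ k ih =>
    rw [pow_succ, pow_succ]
    exact ih.mul (convergesTo_X s)

theorem ConvergesTo.eq_zero {s v : ℂ} (h : ConvergesTo 0 s v) : v = 0 := by
  rw [h.2]
  simp

/-- The series `φ`, which is Laurent in `t ^ (1 / N)`, has the value `v` at `t ^ (1 / N) = s`. -/
def HasValue {N : ℕ} (hN : 0 < N) (s : ℂ) (φ : HahnSeries ℚ ℂ) (v : ℂ) : Prop :=
  ∃ (k : ℕ) (P : PowerSeries ℂ), ConvergesTo P s (v * s ^ k) ∧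
    φ * puiseuxHom hN (PowerSeries.X ^ k) = puiseuxHom hN P

section HasValue

variable {N : ℕ} {hN : 0 < N} {s v w : ℂ} {φ ψ : HahnSeries ℚ ℂ}

theorem HasValue.add (hφ : HasValue hN s φ v) (hψ : HasValue hN s ψ w) :
    HasValue hN s (φ + ψ) (v + w) := by
  obtain ⟨k, P, hP, eP⟩ := hφ
  obtain ⟨l, Q, hQ, eQ⟩ := hψ
  refine ⟨k + l, P * PowerSeries.X ^ l + Q * PowerSeries.X ^ k, ?_, ?_⟩
  · convert (hP.mul (convergesTo_X_pow s l)).add (hQ.mul (convergesTo_X_pow s k)) using 1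
    ring
  · rw [map_add, map_mul, map_mul, ← eP, ← eQ, pow_add, map_mul]
    ring

theorem HasValue.mul (hφ : HasValue hN s φ v) (hψ : HasValue hN s ψ w) :
    HasValue hN s (φ * ψ) (v * w) := by
  obtain ⟨k, P, hP, eP⟩ := hφ
  obtain ⟨l, Q, hQ, eQ⟩ := hψ
  refine ⟨k + l, P * Q, ?_, ?_⟩
  · convert hP.mul hQ using 1
    ring
  · rw [map_mul, ← eP, ← eQ, pow_add, map_mul]
    ring

theorem hasValue_puiseuxHom {P : PowerSeries ℂ} (h : ConvergesTo P s v) :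
    HasValue hN s (puiseuxHom hN P) v :=
  ⟨0, P, by simpa using h, by simp⟩

theorem hasValue_tInv (hs : s ≠ 0) : HasValue hN s tInv (s ^ N)⁻¹ := by
  refine ⟨N, PowerSeries.C 1, ?_, ?_⟩
  · rw [inv_mul_cancel₀ (pow_ne_zero _ hs)]
    exact convergesTo_C 1 s
  · rw [tInv_mul_puiseuxHom, map_one, map_one]

theorem hasValue_aeval {x : Fin 3 → HahnSeries ℚ ℂ} {y : Fin 3 → ℂ}
    (h : ∀ i, HasValue hN s (x i) (y i)) (f : MvPolynomial (Fin 3) ℂ) :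
    HasValue hN s (MvPolynomial.aeval x f) (MvPolynomial.eval y f) := by
  induction f using MvPolynomial.induction_on with
  | C a =>
    -- The algebra structure on Hahn series used here factors through power series, so constants are
    -- unfolded along that route.
    rw [MvPolynomial.aeval_C, MvPolynomial.eval_C, HahnSeries.algebraMap_apply',
      PowerSeries.algebraMap_apply, Algebra.algebraMap_self_apply, HahnSeries.ofPowerSeries_C,
      ← puiseuxHom_C hN]
    exact hasValue_puiseuxHom (convergesTo_C a s)
  | add p q hp hq =>
    rw [map_add, map_add]
    exact hp.add hq
  | mul_X p i hp =>
    rw [map_mul, map_mul, MvPolynomial.aeval_X, MvPolynomial.eval_X]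
    exact hp.mul (h i)

/-- Injectivity of `puiseuxHom` forces the witnessing power series to be `0`, whatever pole order
`k` was chosen. -/
theorem HasValue.eq_zero (hs : s ≠ 0) (h : HasValue hN s 0 v) : v = 0 := by
  obtain ⟨k, P, hP, eP⟩ := h
  rw [zero_mul, ← map_zero (puiseuxHom hN)] at eP
  rw [← puiseuxHom_injective hN eP] at hP
  exact (mul_eq_zero.mp hP.eq_zero).resolve_right (pow_ne_zero _ hs)

/-- Here `s` may be any `N`-th root of `t`, not only the principal one; this freedom is what yields
the conjugate leaves. -/
theorem eval_eq_zero_of_isFormalZero {f : MvPolynomial (Fin 3) ℂ} {φ₂ φ₃ : HahnSeries ℚ ℂ}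
    {v₂ v₃ : ℂ} (hf : IsFormalZero f φ₂ φ₃) (h₂ : HasDenominator φ₂ N) (h₃ : HasDenominator φ₃ N)
    (hs : s ≠ 0) (hv₂ : ConvergesTo (rootSeries N φ₂) s v₂)
    (hv₃ : ConvergesTo (rootSeries N φ₃) s v₃) :
    MvPolynomial.eval ![(s ^ N)⁻¹, (s ^ N)⁻¹ * v₂, (s ^ N)⁻¹ * v₃] f = 0 := by
  have e₂ := hasValue_puiseuxHom (hN := h₂.1) hv₂
  have e₃ := hasValue_puiseuxHom (hN := h₂.1) hv₃
  rw [h₂.puiseuxHom_rootSeries] at e₂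
  rw [h₃.puiseuxHom_rootSeries] at e₃
  have ht := hasValue_tInv (hN := h₂.1) hs
  have h := hasValue_aeval (hN := h₂.1) (s := s) (x := ![tInv, tInv * φ₂, tInv * φ₃])
    (y := ![(s ^ N)⁻¹, (s ^ N)⁻¹ * v₂, (s ^ N)⁻¹ * v₃]) (by
      intro i
      fin_cases i
      · exact ht
      · exact ht.mul e₂
      · exact ht.mul e₃) f
  unfold IsFormalZero at hf
  rw [hf] at h
  exact h.eq_zero hs

end HasValue

/-! ### The series `r` in terms of a root of `z⁻¹` -/

/-- The principal `N`-th root of `z⁻¹`. -/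
noncomputable def invRoot (N : ℕ) (z : ℂ) : ℂ := z ^ (-(N : ℂ)⁻¹)

theorem invRoot_pow {N : ℕ} (hN : 0 < N) (z : ℂ) : invRoot N z ^ N = z⁻¹ := by
  rw [invRoot, Complex.cpow_neg, inv_pow, Complex.cpow_nat_inv_pow _ hN.ne']

theorem invRoot_ne_zero {N : ℕ} (hN : 0 < N) {z : ℂ} (hz : z ≠ 0) : invRoot N z ≠ 0 := by
  intro h
  have := invRoot_pow hN z
  rw [h, zero_pow hN.ne'] at this
  exact inv_ne_zero hz this.symm

/-- The principal branch causes no trouble: `z ^ (i * a) = (z ^ a) ^ i` holds for natural `i`. -/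
theorem term_conjugate_div {N : ℕ} (hN : 0 < N) (φ : HahnSeries ℚ ℂ) (ε : ℂ) {z : ℂ} (hz : z ≠ 0)
    (i : ℕ) : term (conjugate N ε φ) z ((i : ℚ) / N) =
      z * (PowerSeries.coeff i (rootSeries N φ) * (ε * invRoot N z) ^ i) := by
  have hN' : (N : ℚ) ≠ 0 := by positivity
  have e : (((1 - (i : ℚ) / N : ℚ)) : ℂ) = 1 + (i : ℂ) * (-(N : ℂ)⁻¹) := by
    push_cast
    ring
  have hc : (conjugate N ε φ).coeff ((i : ℚ) / N) = φ.coeff ((i : ℚ) / N) * ε ^ i := by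
    change φ.coeff ((i : ℚ) / N) * ε ^ ((i : ℚ) / N * N).num = _
    rw [div_mul_cancel₀ _ hN', Rat.num_natCast, zpow_natCast]
  rw [term, hc, e, Complex.cpow_add _ _ hz, Complex.cpow_one, Complex.cpow_nat_mul, ← invRoot,
    rootSeries, PowerSeries.coeff_mk, mul_pow]
  ring

theorem term_eq_zero_of_notMem {N : ℕ} {φ : HahnSeries ℚ ℂ} (h : HasDenominator φ N) (ε z : ℂ)
    {q : ℚ} (hq : q ∉ Set.range fun i : ℕ => (i : ℚ) / N) : term (conjugate N ε φ) z q = 0 := by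
  have h0 : φ.coeff q = 0 := by
    by_contra hne
    obtain ⟨i, hi⟩ := h.2 q hne
    exact hq ⟨i, hi.symm⟩
  change φ.coeff q * _ * _ = 0
  rw [h0, zero_mul, zero_mul]

theorem div_natCast_injective {N : ℕ} (hN : 0 < N) :
    Function.Injective fun i : ℕ => (i : ℚ) / N := fun i j h =>
  divExponent_injective hN (by rw [divExponent_apply, divExponent_apply]; exact h)

theorem r_conjugate {N : ℕ} {φ : HahnSeries ℚ ℂ} (h : HasDenominator φ N) (ε : ℂ) {z : ℂ}
    (hz : z ≠ 0) : r (conjugate N ε φ) z =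
      z * ∑' i, PowerSeries.coeff i (rootSeries N φ) * (ε * invRoot N z) ^ i := by
  rw [r, ← (div_natCast_injective h.1).tsum_eq, ← tsum_mul_left]
  · exact tsum_congr fun i => term_conjugate_div h.1 φ ε hz i
  · intro q hq
    by_contra hq'
    exact hq (term_eq_zero_of_notMem h ε z hq')

theorem conjugate_one (N : ℕ) (φ : HahnSeries ℚ ℂ) : conjugate N 1 φ = φ := by
  ext q
  change φ.coeff q * 1 ^ _ = _
  rw [one_zpow, mul_one]

theorem summable_norm_rootSeries {N : ℕ} {φ : HahnSeries ℚ ℂ} (hN : 0 < N) {z : ℂ} (hz : z ≠ 0)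
    (hs : Summable (term φ z)) :
    Summable fun i => ‖PowerSeries.coeff i (rootSeries N φ) * invRoot N z ^ i‖ := by
  have h := hs.comp_injective (div_natCast_injective hN)
  refine ((summable_mul_left_iff hz).mp (h.congr fun i => ?_)).norm
  have := term_conjugate_div hN φ 1 hz i
  rwa [conjugate_one, one_mul] at this

/-- Since `‖ε‖ = 1`, absolute convergence at the principal root carries over to every other root. -/
theorem convergesTo_rootSeries {N : ℕ} {φ : HahnSeries ℚ ℂ} (hN : 0 < N) {z : ℂ} (hz : z ≠ 0)
    (hs : Summable (term φ z)) {ε : ℂ} (hε : ε ^ N = 1) :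
    ConvergesTo (rootSeries N φ) (ε * invRoot N z)
      (∑' i, PowerSeries.coeff i (rootSeries N φ) * (ε * invRoot N z) ^ i) := by
  have h1 : ‖ε‖ = 1 := Complex.norm_eq_one_of_pow_eq_one hε hN.ne'
  refine ⟨(summable_norm_rootSeries hN hz hs).congr fun i => ?_, rfl⟩
  rw [norm_mul, norm_mul, norm_pow, norm_pow, norm_mul, h1, one_mul]

/-! ### Conjugate leaves -/

section Branch

variable {f₁ f₂ : MvPolynomial (Fin 3) ℂ} {m₂ m₃ : ℂ} {φ₂ φ₃ : HahnSeries ℚ ℂ} {M : ℝ}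

theorem IsInfinityBranch.branchRamification_pos (hB : IsInfinityBranch f₁ f₂ m₂ m₃ φ₂ φ₃ M) :
    0 < branchRamification φ₂ φ₃ :=
  Nat.lcm_pos (hasDenominator_ramificationIndex hB.puiseux₂).1
    (hasDenominator_ramificationIndex hB.puiseux₃).1

theorem IsInfinityBranch.hasDenominator₂ (hB : IsInfinityBranch f₁ f₂ m₂ m₃ φ₂ φ₃ M) :
    HasDenominator φ₂ (branchRamification φ₂ φ₃) :=
  (hasDenominator_ramificationIndex hB.puiseux₂).of_dvd hB.branchRamification_pos
    (Nat.dvd_lcm_left _ _)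

theorem IsInfinityBranch.hasDenominator₃ (hB : IsInfinityBranch f₁ f₂ m₂ m₃ φ₂ φ₃ M) :
    HasDenominator φ₃ (branchRamification φ₂ φ₃) :=
  (hasDenominator_ramificationIndex hB.puiseux₃).of_dvd hB.branchRamification_pos
    (Nat.dvd_lcm_right _ _)

theorem IsInfinityBranch.ne_zero (hB : IsInfinityBranch f₁ f₂ m₂ m₃ φ₂ φ₃ M) {z : ℂ}
    (hz : M < ‖z‖) : z ≠ 0 :=
  norm_pos_iff.mp (hB.pos.trans hz)

theorem IsInfinityBranch.branchPoint_conjugate_mem (hB : IsInfinityBranch f₁ f₂ m₂ m₃ φ₂ φ₃ M)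
    {ε : ℂ} (hε : ε ^ branchRamification φ₂ φ₃ = 1) {z : ℂ} (hz : M < ‖z‖) :
    branchPoint (conjugate (branchRamification φ₂ φ₃) ε φ₂)
      (conjugate (branchRamification φ₂ φ₃) ε φ₃) z ∈ locus f₁ f₂ := by
  have hN := hB.branchRamification_pos
  have h₂ := hB.hasDenominator₂
  have h₃ := hB.hasDenominator₃
  have hz0 := hB.ne_zero hz
  have hε0 : ε ≠ 0 := by
    rintro rfl
    rw [zero_pow hN.ne'] at hε
    exact zero_ne_one hε
  have hs : ε * invRoot (branchRamification φ₂ φ₃) z ≠ 0 :=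
    mul_ne_zero hε0 (invRoot_ne_zero hN hz0)
  have hsN : ((ε * invRoot (branchRamification φ₂ φ₃) z) ^ branchRamification φ₂ φ₃)⁻¹ = z := by
    rw [mul_pow, hε, one_mul, invRoot_pow hN, inv_inv]
  have c₂ := convergesTo_rootSeries hN hz0 (hB.summable₂ z hz) hε
  have c₃ := convergesTo_rootSeries hN hz0 (hB.summable₃ z hz) hε
  have e₁ := eval_eq_zero_of_isFormalZero hB.solves₁ h₂ h₃ hs c₂ c₃
  have e₂ := eval_eq_zero_of_isFormalZero hB.solves₂ h₂ h₃ hs c₂ c₃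
  rw [hsN] at e₁ e₂
  rw [branchPoint, r_conjugate h₂ ε hz0, r_conjugate h₃ ε hz0]
  exact ⟨e₁, e₂⟩

end Branch

/-! ### Separation of the conjugate points -/

/-- A power series with a nonzero coefficient that converges somewhere away from the centre does
not vanish in a punctured neighbourhood of the centre. -/
theorem eventually_tsum_ne_zero {c : ℕ → ℂ} {s₀ : ℂ} (hs₀ : s₀ ≠ 0)
    (hc : Summable fun i => ‖c i * s₀ ^ i‖) (hne : ∃ i, c i ≠ 0) :
    ∀ᶠ s in 𝓝[≠] (0 : ℂ), ∑' i, c i * s ^ i ≠ 0 := by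
  set p := FormalMultilinearSeries.ofScalars ℂ c with hp
  have hrad : (‖s₀‖₊ : ENNReal) ≤ p.radius := by
    refine p.le_radius_of_summable (hc.congr fun i => ?_)
    rw [hp, FormalMultilinearSeries.ofScalars_norm, norm_mul, norm_pow, coe_nnnorm]
  have hpos : 0 < p.radius := lt_of_lt_of_le (by simpa using hs₀) hrad
  have hp0 : p ≠ 0 := by
    rw [hp, Ne, FormalMultilinearSeries.ofScalars_series_eq_zero]
    rintro rfl
    simp at hne
  refine ((p.hasFPowerSeriesOnBall hpos).hasFPowerSeriesAt.locally_ne_zero hp0).mono fun s hs => ?_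
  rw [← FormalMultilinearSeries.ofScalarsSum, FormalMultilinearSeries.ofScalars_sum_eq] at hs
  simpa only [smul_eq_mul] using hs

/-- The difference is `z` times the series with coefficients `a_i (ε ^ i - δ ^ i)` at `s`. Phrasing
it as an eventual property of `s` near `0` lets finitely many pairs be intersected. -/
theorem eventually_r_conjugate_ne {N : ℕ} {φ : HahnSeries ℚ ℂ} (h : HasDenominator φ N) {M : ℝ}
    (hM : 0 < M) (hs : ∀ z : ℂ, M < ‖z‖ → Summable (term φ z)) {ε δ : ℂ} (hε : ε ^ N = 1)
    (hδ : δ ^ N = 1) (hne : ∃ i : ℕ, φ.coeff ((i : ℚ) / N) * (ε ^ i - δ ^ i) ≠ 0) :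
    ∀ᶠ s in 𝓝[≠] (0 : ℂ), ∀ z : ℂ, M < ‖z‖ → s = invRoot N z →
      r (conjugate N ε φ) z ≠ r (conjugate N δ φ) z := by
  have hsplit : ∀ (i : ℕ) (s : ℂ), φ.coeff ((i : ℚ) / N) * (ε ^ i - δ ^ i) * s ^ i =
      PowerSeries.coeff i (rootSeries N φ) * (ε * s) ^ i -
        PowerSeries.coeff i (rootSeries N φ) * (δ * s) ^ i := fun i s => by
    rw [rootSeries, PowerSeries.coeff_mk]
    ring
  have hz0 : ∀ z : ℂ, M < ‖z‖ → z ≠ 0 := fun z hz => norm_pos_iff.mp (hM.trans hz)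
  -- Convergence at this one point suffices for a positive radius in `s`.
  have hz₁ : M < ‖((M + 1 : ℝ) : ℂ)‖ := by
    rw [Complex.norm_real, Real.norm_of_nonneg (by linarith)]
    linarith
  have hsum : ∀ {z : ℂ}, M < ‖z‖ → ∀ {η : ℂ}, η ^ N = 1 → Summable fun i =>
      PowerSeries.coeff i (rootSeries N φ) * (η * invRoot N z) ^ i := fun hz _ hη =>
    (convergesTo_rootSeries h.1 (hz0 _ hz) (hs _ hz) hη).1.of_norm
  refine (eventually_tsum_ne_zero (invRoot_ne_zero h.1 (hz0 _ hz₁)) ?_ hne).mono ?_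
  · simp only [hsplit]
    exact ((hsum hz₁ hε).sub (hsum hz₁ hδ)).norm
  · rintro s hs' z hz rfl heq
    rw [r_conjugate h ε (hz0 z hz), r_conjugate h δ (hz0 z hz)] at heq
    simp only [hsplit] at hs'
    rw [(hsum hz hε).tsum_sub (hsum hz hδ), mul_left_cancel₀ (hz0 z hz) heq, sub_self] at hs'
    exact hs' rfl

theorem setOf_pow_eq_one_eq {N : ℕ} (hN : 0 < N) :
    {ε : ℂ | ε ^ N = 1} = (Polynomial.nthRootsFinset N (1 : ℂ) : Set ℂ) := by
  ext ε
  simp [Polynomial.mem_nthRootsFinset hN]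

theorem encard_setOf_pow_eq_one {N : ℕ} (hN : 0 < N) : {ε : ℂ | ε ^ N = 1}.encard = N := by
  rw [setOf_pow_eq_one_eq hN, Set.encard_coe_eq_coe_finsetCard,
    (Complex.isPrimitiveRoot_exp N hN.ne').card_nthRootsFinset]

theorem IsInfinityBranch.exists_injOn_branchPoint {f₁ f₂ : MvPolynomial (Fin 3) ℂ} {m₂ m₃ : ℂ}
    {φ₂ φ₃ : HahnSeries ℚ ℂ} {M : ℝ} (hB : IsInfinityBranch f₁ f₂ m₂ m₃ φ₂ φ₃ M) :
    ∃ M' : ℝ, M ≤ M' ∧ ∀ z : ℂ, M' < ‖z‖ →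
      Set.InjOn (fun ε : ℂ => branchPoint (conjugate (branchRamification φ₂ φ₃) ε φ₂)
        (conjugate (branchRamification φ₂ φ₃) ε φ₃) z)
        {ε : ℂ | ε ^ branchRamification φ₂ φ₃ = 1} := by
  have hN := hB.branchRamification_pos
  have h₂ := hB.hasDenominator₂
  have h₃ := hB.hasDenominator₃
  have hpair := fun {ε δ : ℂ} hε hδ hne =>
    exists_coeff_ne_zero_pow_ne hB.puiseux₂ hB.puiseux₃ (ε := ε) (δ := δ) hε hδ hne
  set N := branchRamification φ₂ φ₃ with hNdef
  have hfin : {ε : ℂ | ε ^ N = 1}.Finite := by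
    rw [setOf_pow_eq_one_eq hN]
    exact Finset.finite_toSet _
  have hev : ∀ᶠ s in 𝓝[≠] (0 : ℂ), ∀ ε ∈ {ε : ℂ | ε ^ N = 1}, ∀ δ ∈ {ε : ℂ | ε ^ N = 1}, ε ≠ δ →
      ∀ z : ℂ, M < ‖z‖ → s = invRoot N z →
        branchPoint (conjugate N ε φ₂) (conjugate N ε φ₃) z ≠
          branchPoint (conjugate N δ φ₂) (conjugate N δ φ₃) z := by
    rw [eventually_all_finite hfin]
    intro ε hε
    rw [eventually_all_finite hfin]
    intro δ hδ
    by_cases hne : ε = δ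
    · exact Eventually.of_forall fun s h => absurd hne h
    rcases hpair hε hδ hne with h | h
    · refine (eventually_r_conjugate_ne h₂ hB.pos hB.summable₂ hε hδ h).mono ?_
      exact fun s hs _ z hz hsz heq => hs z hz hsz (congrFun heq 1)
    · refine (eventually_r_conjugate_ne h₃ hB.pos hB.summable₃ hε hδ h).mono ?_
      exact fun s hs _ z hz hsz heq => hs z hz hsz (congrFun heq 2)
  rw [eventually_nhdsWithin_iff, Metric.eventually_nhds_iff] at hev
  obtain ⟨ρ, hρ, hev⟩ := hev
  -- As `invRoot N z ^ N = z⁻¹`, the bound `‖z‖ > (ρ ^ N)⁻¹` puts `invRoot N z` within `ρ` of `0`.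
  refine ⟨max M (ρ ^ N)⁻¹, le_max_left _ _, fun z hz ε hε δ hδ heq => ?_⟩
  have hzM : M < ‖z‖ := (le_max_left _ _).trans_lt hz
  have hzρ : (ρ ^ N)⁻¹ < ‖z‖ := (le_max_right _ _).trans_lt hz
  by_contra hne
  refine hev (y := invRoot N z) ?_ (invRoot_ne_zero hN (hB.ne_zero hzM)) ε hε δ hδ hne z hzM rfl heq
  rw [dist_zero_right]
  refine lt_of_pow_lt_pow_left₀ N hρ.le ?_
  rw [← norm_pow, invRoot_pow hN, norm_inv]
  exact inv_lt_of_inv_lt₀ (by positivity) hzρ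

theorem IsInfinityBranch.exists_encard_image_branchPoint {f₁ f₂ : MvPolynomial (Fin 3) ℂ}
    {m₂ m₃ : ℂ} {φ₂ φ₃ : HahnSeries ℚ ℂ} {M : ℝ} (hB : IsInfinityBranch f₁ f₂ m₂ m₃ φ₂ φ₃ M) :
    ∃ M' : ℝ, M ≤ M' ∧ ∀ z : ℂ, M' < ‖z‖ →
      ((fun ε : ℂ => branchPoint (conjugate (branchRamification φ₂ φ₃) ε φ₂)
        (conjugate (branchRamification φ₂ φ₃) ε φ₃) z) ''
        {ε : ℂ | ε ^ branchRamification φ₂ φ₃ = 1}).encard = (branchRamification φ₂ φ₃ : ℕ∞) ∧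
      (fun ε : ℂ => branchPoint (conjugate (branchRamification φ₂ φ₃) ε φ₂)
        (conjugate (branchRamification φ₂ φ₃) ε φ₃) z) ''
        {ε : ℂ | ε ^ branchRamification φ₂ φ₃ = 1} ⊆ locus f₁ f₂ ∩ {x | x 0 = z} := by
  obtain ⟨M', hMM', hinj⟩ := hB.exists_injOn_branchPoint
  refine ⟨M', hMM', fun z hz => ⟨(hinj z hz).encard_image.trans
    (encard_setOf_pow_eq_one hB.branchRamification_pos), ?_⟩⟩
  rintro _ ⟨ε, hε, rfl⟩
  exact ⟨hB.branchPoint_conjugate_mem hε (hMM'.trans_lt hz), rfl⟩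

theorem natCast_le_degree {C : Set (Fin 3 → ℂ)} {N : ℕ} {z : ℂ} {S : Set (Fin 3 → ℂ)}
    (hS : S.encard = N) (hSC : S ⊆ C ∩ {x | x 0 = z}) (hC : ∃ x ∈ C, x 0 ≠ z) :
    (N : ℕ∞) ≤ degree C := by
  have hH : IsPlane {x : Fin 3 → ℂ | x 0 = z} := by
    refine ⟨Pi.single 0 1, z, ?_, ?_⟩
    · intro h
      simpa using congrFun h 0
    · ext x
      simp [Pi.single_apply]
  have hCH : ¬ C ⊆ {x : Fin 3 → ℂ | x 0 = z} := by
    obtain ⟨x, hx, hxz⟩ := hC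
    exact fun h => hxz (h hx)
  rw [← hS]
  exact (Set.encard_le_encard hSC).trans
    (le_iSup₂ (f := fun (H : Set (Fin 3 → ℂ)) (_ : H ∈ {H | IsPlane H ∧ ¬ C ⊆ H}) =>
      (C ∩ H).encard) _ ⟨hH, hCH⟩)

end SpaceCurve

theorem mainTheorem6
    (f₁ f₂ : MvPolynomial (Fin 3) ℂ)
    (hC : SpaceCurve.IsIrreducibleCurve (SpaceCurve.locus f₁ f₂))
    (m₂ m₃ : ℂ) (φ₂ φ₃ : HahnSeries ℚ ℂ) (M : ℝ)
    (hB : SpaceCurve.IsInfinityBranch f₁ f₂ m₂ m₃ φ₂ φ₃ M)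
    (N : ℕ) (hN : N = SpaceCurve.branchRamification φ₂ φ₃) :
    (N : ℕ∞) ≤ SpaceCurve.degree (SpaceCurve.locus f₁ f₂) ∧
    (∀ ε : ℂ, ε ^ N = 1 →
      SpaceCurve.leaf (SpaceCurve.conjugate N ε φ₂) (SpaceCurve.conjugate N ε φ₃) M ⊆
        SpaceCurve.locus f₁ f₂) ∧
    ∃ M' : ℝ, M ≤ M' ∧ ∀ z₀ : ℂ, M' < ‖z₀‖ →
      ((fun ε : ℂ => SpaceCurve.branchPoint (SpaceCurve.conjugate N ε φ₂)
          (SpaceCurve.conjugate N ε φ₃) z₀) '' {ε : ℂ | ε ^ N = 1}).encard = (N : ℕ∞) ∧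
      (fun ε : ℂ => SpaceCurve.branchPoint (SpaceCurve.conjugate N ε φ₂)
          (SpaceCurve.conjugate N ε φ₃) z₀) '' {ε : ℂ | ε ^ N = 1} ⊆
        SpaceCurve.locus f₁ f₂ ∩ {x | x 0 = z₀} := by
  subst hN
  obtain ⟨M', hMM', hpts⟩ := hB.exists_encard_image_branchPoint
  refine ⟨?_, ?_, M', hMM', hpts⟩
  · have hM'0 : 0 < M' := hB.pos.trans_le hMM'
    -- The plane `x₁ = M' + 1` carries the `N` points; the leaf `ε = 1` at `M' + 2` supplies a point
    -- of the curve outside it.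
    have h₁ : M' < ‖((M' + 1 : ℝ) : ℂ)‖ := by
      rw [Complex.norm_real, Real.norm_of_nonneg (by linarith)]
      linarith
    have h₂ : M' < ‖((M' + 2 : ℝ) : ℂ)‖ := by
      rw [Complex.norm_real, Real.norm_of_nonneg (by linarith)]
      linarith
    refine SpaceCurve.natCast_le_degree (hpts _ h₁).1 (hpts _ h₁).2
      ⟨_, hB.branchPoint_conjugate_mem (one_pow _) (hMM'.trans_lt h₂), fun h => ?_⟩
    have h' := Complex.ofReal_injective h
    linarith
  · rintro ε hε _ ⟨z, hz, rfl⟩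
    exact hB.branchPoint_conjugate_mem hε hz
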